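/- For $n\ge 1$ let $\mathfrak{B}_n$ be the hyperoctahedral group, that is, the group of signed permutations of $\{1,\dots,n\}$: the permutations $\sigma$ of $\{-n,\dots,-1,0,1,\dots,n\}$ with $\sigma(-i)=-\sigma(i)$ for all $i$ (so $\sigma(0)=0$). Write $\sigma_i=\sigma(i)$, and let $$\mathrm{des}_B(\sigma)=\left|\{\,i\in\{0,1,\dots,n-1\} : \sigma_i>\sigma_{i+1}\,\}\right|,\qquad \sigma_0=0,$$ be the number of type $B$ descents of $\sigma$. Let $$B_n(s,t)=\sum_{\sigma\in\mathfrak{B}_n}s^{\mathrm{des}_B(\sigma)}\,t^{\mathrm{des}_B(\sigma^{-1})}\in\mathbb{Z}[s,t]$$ be the type $B$ two-sided Eulerian polynomial. **Theorem.** For every $n\ge 2$, $$\begin{aligned} nB_n(s,t)={}&(2n^2st-nst+n)\,B_{n-1}(s,t)\\ &+\bigl(2nst(1-s)+s(1-s)(1-t)\bigr)\frac{\partial}{\partial s}B_{n-1}(s,t)\\ &+\bigl(2nst(1-t)+t(1-s)(1-t)\bigr)\frac{\partial}{\partial t}B_{n-1}(s,t)\\ &+2st(1-s)(1-t)\frac{\partial^2}{\partial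 s\,\partial t}B_{n-1}(s,t), \end{aligned}$$ with initial value $B_1(s,t)=1+st$. -/

import Mathlib

open MvPolynomial

/-- The set `{-n, …, -1, 0, 1, …, n}` of integers. -/
abbrev SignedRange (n : ℕ) : Type := ↥(Finset.Icc (-(n : ℤ)) (n : ℤ))

/-- The map `i ↦ -i` on `{-n, …, n}`. -/
def SignedRange.neg {n : ℕ} (i : SignedRange n) : SignedRange n :=
  ⟨-(i : ℤ), by
    have h := Finset.mem_Icc.mp i.2
    exact Finset.mem_Icc.mpr ⟨by omega, by omega⟩⟩

/-- The element `i` of `{0, 1, …, n}`, seen as an element of `{-n, …, n}`. -/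
def SignedRange.ofFin {n : ℕ} (i : Fin (n + 1)) : SignedRange n :=
  ⟨((i : ℕ) : ℤ), by
    have h := i.isLt
    exact Finset.mem_Icc.mpr ⟨by omega, by omega⟩⟩

/-- The hyperoctahedral group `𝔅_n` of signed permutations of `{1, …, n}`: the permutations `σ` of
`{-n, …, n}` with `σ(-i) = -σ(i)` for all `i` (so that `σ(0) = 0`). -/
def hyperoctahedralGroup (n : ℕ) : Subgroup (Equiv.Perm (SignedRange n)) where
  carrier := {σ | ∀ i, σ i.neg = (σ i).neg}
  mul_mem' := by
    intro σ τ hσ hτ i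
    rw [Equiv.Perm.mul_apply, Equiv.Perm.mul_apply, hτ i, hσ (τ i)]
  one_mem' := fun _ => rfl
  inv_mem' := by
    intro σ hσ i
    rw [Equiv.Perm.inv_eq_iff_eq, hσ, ← Equiv.Perm.mul_apply, mul_inv_cancel, Equiv.Perm.one_apply]

noncomputable instance (n : ℕ) : DecidablePred (· ∈ hyperoctahedralGroup n) := fun σ =>
  inferInstanceAs (Decidable (∀ i, σ i.neg = (σ i).neg))

/-- Every signed permutation satisfies `σ_0 = 0`. -/
theorem hyperoctahedralGroup_apply_zero {n : ℕ} (σ : hyperoctahedralGroup n) :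
    ((σ.1 (SignedRange.ofFin 0) : SignedRange n) : ℤ) = 0 := by
  have h0 : (SignedRange.ofFin (0 : Fin (n + 1))).neg = SignedRange.ofFin 0 := by
    apply Subtype.ext
    simp [SignedRange.neg, SignedRange.ofFin]
  have h := congrArg Subtype.val (σ.2 (SignedRange.ofFin 0))
  rw [h0] at h
  simp only [SignedRange.neg] at h
  omega

/-- The number of type `B` descents of `σ = σ_1 … σ_n`, that is, the number of
`i ∈ {0, 1, …, n - 1}` with `σ_i > σ_{i+1}`, where `σ_0 = 0`. -/
def desB {n : ℕ} (σ : hyperoctahedralGroup n) : ℕ :=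
  (Finset.univ.filter fun i : Fin n =>
    (σ.1 (SignedRange.ofFin i.castSucc) : ℤ) > (σ.1 (SignedRange.ofFin i.succ) : ℤ)).card

/-- The type `B` two-sided Eulerian polynomial
`B_n(s, t) = ∑_{σ ∈ 𝔅_n} s ^ des_B(σ) * t ^ des_B(σ⁻¹)`, with `s = X 0` and `t = X 1`. -/
noncomputable def eulerianB (n : ℕ) : MvPolynomial (Fin 2) ℤ :=
  ∑ σ : hyperoctahedralGroup n, X 0 ^ desB σ * X 1 ^ desB σ⁻¹

/-! Everything follows from the expansion B_n(s,t) / ((1-s)(1-t))^(n+1) = ∑ C(2ij+i+j+n, n) s^i t^j,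
proved coefficientwise in `sum_shiftedChoose_desB`. The right side counts odd monotone z on {-n,…,n}
with |z| ≤ 2ij+i+j. Division with remainder in [-j,j] writes z = (2j+1)x + y; sorting the pairs
(y_k, k) produces a signed permutation, and z becomes a pair of sequences, bounded by i and j, that
increase weakly, and strictly at the descents of σ and σ⁻¹ respectively (`sum_ncard_oddSequences`).
For fixed σ such pairs are counted by the coefficient of s^i t^j in s^des(σ) t^des(σ⁻¹) /
((1-s)(1-t))^(n+1). With N = 2ij+i+j, the recurrence is then n C(N+n, n) = (N+n) C(N+n-1, n-1):
multiplication by i and j on coefficients is s∂/∂s and t∂/∂t on series, and clearing denominators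
gives the stated operator (`expansionCoeff_eulerianOperator_monomial`). -/

/-- The coefficient of `x ^ i` in the power series `x ^ a / (1 - x) ^ (n + 1)`. -/
def shiftedChoose (n a i : ℕ) : ℤ := if a ≤ i then ((i - a + n).choose n : ℤ) else 0

theorem shiftedChoose_of_le {n a i : ℕ} (h : a ≤ i) :
    shiftedChoose n a i = ((i - a + n).choose n : ℤ) := if_pos h

theorem shiftedChoose_of_lt {n a i : ℕ} (h : i < a) : shiftedChoose n a i = 0 :=
  if_neg (by omega)

theorem shiftedChoose_succ_right (n a i : ℕ) :
    shiftedChoose (n + 1) a (i + 1) = shiftedChoose (n + 1) a i + shiftedChoose n a (i + 1) := by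
  rcases lt_trichotomy a (i + 1) with h | rfl | h
  · obtain ⟨r, rfl⟩ := Nat.exists_eq_add_of_le (Nat.lt_succ_iff.mp h)
    rw [shiftedChoose_of_le (by omega), shiftedChoose_of_le (by omega),
      shiftedChoose_of_le (by omega), show a + r + 1 - a + (n + 1) = (r + n + 1) + 1 by omega,
      show a + r - a + (n + 1) = r + n + 1 by omega, show a + r + 1 - a + n = r + n + 1 by omega,
      Nat.choose_succ_succ]
    push_cast
    ring
  · simp [shiftedChoose]
  · simp [shiftedChoose_of_lt h, shiftedChoose_of_lt (show i < a by omega)]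

theorem shiftedChoose_sub (n a i : ℕ) :
    shiftedChoose (n + 1) a i - shiftedChoose (n + 1) (a + 1) i = shiftedChoose n a i := by
  cases i with
  | zero => cases a <;> simp [shiftedChoose]
  | succ i =>
    have h : shiftedChoose (n + 1) (a + 1) (i + 1) = shiftedChoose (n + 1) a i := by
      simp [shiftedChoose]
    rw [h, shiftedChoose_succ_right]
    ring

/-- Coefficient form of x d/dx [x^a/(1-x)^(n+1)] = (a x^a + (n+1-a) x^(a+1))/(1-x)^(n+2). -/
theorem mul_shiftedChoose (n a i : ℕ) :
    a * shiftedChoose (n + 1) a i + (n + 1 - a) * shiftedChoose (n + 1) (a + 1) i =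
      i * shiftedChoose n a i := by
  rcases lt_trichotomy i a with h | rfl | h
  · simp [shiftedChoose_of_lt h, shiftedChoose_of_lt (show i < a + 1 by omega)]
  · simp [shiftedChoose]
  · obtain ⟨r, rfl⟩ := Nat.exists_eq_add_of_lt h
    have h1 := shiftedChoose_sub n a (a + r + 1)
    have h2 : shiftedChoose (n + 1) (a + 1) (a + r + 1) * (n + 1) =
        (r + 1) * shiftedChoose n a (a + r + 1) := by
      rw [shiftedChoose_of_le (by omega), shiftedChoose_of_le (by omega),
        show a + r + 1 - (a + 1) + (n + 1) = r + n + 1 by omega,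
        show a + r + 1 - a + n = r + n + 1 by omega]
      have := Nat.choose_succ_right_eq (r + n + 1) n
      rw [show r + n + 1 - n = r + 1 by omega] at this
      rw [mul_comm ((r : ℤ) + 1)]
      exact_mod_cast this
    push_cast
    linear_combination (a : ℤ) * h1 + h2

/-! ### Counting sequences with prescribed minimal steps -/

/-- Integer sequences `0 = v_0, v_1, …, v_n ≤ i` whose `k`-th step is at least `D k`. -/
def stepSequences {n : ℕ} (D : Fin n → ℕ) (i : ℤ) : Set (Fin (n + 1) → ℤ) :=
  {v | v 0 = 0 ∧ (∀ k : Fin n, v k.castSucc + D k ≤ v k.succ) ∧ v (Fin.last n) ≤ i}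

theorem monotone_of_mem_stepSequences {n : ℕ} {D : Fin n → ℕ} {i : ℤ} {v : Fin (n + 1) → ℤ}
    (hv : v ∈ stepSequences D i) : Monotone v :=
  Fin.monotone_iff_le_succ.2 fun k => by have := hv.2.1 k; omega

theorem finite_stepSequences {n : ℕ} (D : Fin n → ℕ) (i : ℤ) : (stepSequences D i).Finite := by
  refine (Set.finite_Icc (fun _ => 0) (fun _ => i)).subset fun v hv => ?_
  have hm := monotone_of_mem_stepSequences hv
  exact ⟨fun k => hv.1 ▸ hm (Fin.zero_le k), fun k => (hm (Fin.le_last k)).trans hv.2.2⟩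

theorem stepSequences_eq_empty {n : ℕ} (D : Fin n → ℕ) {i : ℤ} (hi : i < 0) :
    stepSequences D i = ∅ := by
  refine Set.eq_empty_of_forall_notMem fun v hv => ?_
  have := monotone_of_mem_stepSequences hv (Fin.zero_le (Fin.last n))
  have := hv.1
  have := hv.2.2
  omega

/-- Either the last entry is at most i - 1, or it equals i and can be deleted. -/
theorem ncard_stepSequences_succ {n : ℕ} (D : Fin (n + 1) → ℕ) (i : ℤ) :
    (stepSequences D i).ncard = (stepSequences D (i - 1)).ncard +
      (stepSequences (fun k : Fin n => D k.castSucc) (i - D (Fin.last n))).ncard := by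
  have hinj : Function.Injective
      (fun v : Fin (n + 1) → ℤ => (Fin.snoc v i : Fin (n + 2) → ℤ)) := fun v w h => by
    simpa using congrArg (Fin.init (α := fun _ => ℤ)) h
  rw [← Set.ncard_image_of_injective (stepSequences (fun k : Fin n => D k.castSucc) _) hinj,
    ← Set.ncard_union_eq ?_ (finite_stepSequences _ _) ((finite_stepSequences _ _).image _)]
  · congr 1
    ext v
    induction v using Fin.snocCases with
    | snoc v x =>
    have key (x i : ℤ) : (Fin.snoc v x : Fin (n + 2) → ℤ) ∈ stepSequences D i ↔
        v ∈ stepSequences (fun k : Fin n => D k.castSucc) (x - D (Fin.last n)) ∧ x ≤ i := by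
      have h0 : (Fin.snoc v x : Fin (n + 2) → ℤ) 0 = v 0 :=
        Fin.snoc_castSucc (α := fun _ => ℤ) x v 0
      simp only [stepSequences, Set.mem_ofPred_eq, Fin.forall_fin_succ', Fin.succ_last,
        Fin.snoc_last, Fin.succ_castSucc, h0, Fin.snoc_castSucc, le_sub_iff_add_le]
      tauto
    rw [Set.mem_union, key, key]
    constructor
    · rintro ⟨h, hx⟩
      rcases hx.lt_or_eq with hx | rfl
      · exact Or.inl ⟨h, by omega⟩
      · exact Or.inr ⟨v, h, rfl⟩
    · rintro (⟨h, hx⟩ | ⟨w, hw, he⟩)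
      · exact ⟨h, by omega⟩
      · have h1 : w = v := by simpa using congrArg (Fin.init (α := fun _ => ℤ)) he
        have h2 : i = x := by simpa using congrFun he (Fin.last _)
        subst h1 h2
        exact ⟨hw, le_rfl⟩
  · rw [Set.disjoint_left]
    rintro _ hv ⟨w, -, rfl⟩
    have := hv.2.2
    simp at this

theorem ncard_stepSequences {n : ℕ} (D : Fin n → ℕ) (i : ℕ) :
    ((stepSequences D i).ncard : ℤ) = shiftedChoose n (∑ k, D k) i := by
  induction n generalizing i with
  | zero =>
    have : stepSequences D i = {fun _ => 0} := by
      ext v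
      simp only [stepSequences, Set.mem_ofPred_eq, Set.mem_singleton_iff, funext_iff]
      constructor
      · rintro ⟨h, -⟩ k
        rwa [Fin.fin_one_eq_zero k]
      · intro h
        simp [h]
    simp [this, shiftedChoose]
  | succ n ih =>
    have aux (m : ℕ) : ((stepSequences (fun k : Fin n => D k.castSucc)
        (m - D (Fin.last n))).ncard : ℤ) = shiftedChoose n (∑ k, D k) m := by
      rw [Fin.sum_univ_castSucc]
      by_cases h : D (Fin.last n) ≤ m
      · obtain ⟨r, rfl⟩ := Nat.exists_eq_add_of_le h
        rw [show ((D (Fin.last n) + r : ℕ) : ℤ) - D (Fin.last n) = r by push_cast; ring, ih]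
        simp only [shiftedChoose, add_comm _ (D (Fin.last n)), add_le_add_iff_left,
          Nat.add_sub_add_left]
      · rw [stepSequences_eq_empty _ (by omega), shiftedChoose_of_lt (by omega)]
        simp
    induction i with
    | zero =>
      rw [ncard_stepSequences_succ, stepSequences_eq_empty D (by simp), Set.ncard_empty, zero_add,
        aux]
      simp [shiftedChoose]
    | succ i ihi =>
      rw [ncard_stepSequences_succ, Nat.cast_add, aux, shiftedChoose_succ_right, ← ihi]
      simp

/-! ### Lexicographic order through balanced division -/

section Pairing

variable {m x y x' y' : ℤ}

/-- For second coordinates in `[-m, m]`, the map `(x, y) ↦ (2 m + 1) x + y` is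
lexicographically monotone. -/
theorem pairing_lt_iff (hy : |y| ≤ m) (hy' : |y'| ≤ m) :
    (2 * m + 1) * x + y < (2 * m + 1) * x' + y' ↔ x < x' ∨ x = x' ∧ y < y' := by
  rw [abs_le] at hy hy'
  rcases lt_trichotomy x x' with h | rfl | h
  · simp only [h, true_or, iff_true]
    nlinarith
  · simp
  · simp only [h.not_gt, h.ne', false_and, or_self, iff_false, not_lt]
    nlinarith

theorem pairing_inj (hy : |y| ≤ m) (hy' : |y'| ≤ m)
    (h : (2 * m + 1) * x + y = (2 * m + 1) * x' + y') : x = x' ∧ y = y' := by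
  have h1 := (pairing_lt_iff (x := x) (x' := x') hy hy').not.1 h.not_lt
  have h2 := (pairing_lt_iff (x := x') (x' := x) hy' hy).not.1 h.not_gt
  omega

theorem exists_pairing (hm : 0 ≤ m) (z : ℤ) : ∃ x y, |y| ≤ m ∧ z = (2 * m + 1) * x + y := by
  have h1 := Int.emod_add_mul_ediv (z + m) (2 * m + 1)
  have h2 := Int.emod_nonneg (z + m) (show 2 * m + 1 ≠ 0 by omega)
  have h3 := Int.emod_lt_of_pos (z + m) (show 0 < 2 * m + 1 by omega)
  exact ⟨(z + m) / (2 * m + 1), (z + m) % (2 * m + 1) - m, abs_le.2 ⟨by omega, by omega⟩,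
    by linarith⟩

end Pairing

/-! ### Odd functions on {-n,…,n} -/

namespace SignedRange

variable {n : ℕ}

theorem abs_coe_le (k : SignedRange n) : |(k : ℤ)| ≤ n := abs_le.2 (Finset.mem_Icc.1 k.2)

@[simp] theorem coe_neg (k : SignedRange n) : (k.neg : ℤ) = -k := rfl

@[simp] theorem coe_ofFin (a : Fin (n + 1)) : (ofFin a : ℤ) = (a : ℕ) := rfl

@[simp] theorem neg_neg (k : SignedRange n) : k.neg.neg = k := Subtype.ext (by simp)

theorem neg_ofFin_zero : (ofFin (0 : Fin (n + 1))).neg = ofFin 0 := Subtype.ext (by simp)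

theorem neg_lt_neg {k l : SignedRange n} (h : k < l) : l.neg < k.neg :=
  Subtype.coe_lt_coe.1 (by have := Subtype.coe_lt_coe.2 h; simpa using this)

theorem ofFin_strictMono : StrictMono (ofFin : Fin (n + 1) → SignedRange n) := fun a b h =>
  Subtype.coe_lt_coe.1 (by simpa using h)

theorem exists_ofFin (k : SignedRange n) : ∃ a : Fin (n + 1), k = ofFin a ∨ k = (ofFin a).neg := by
  have := Finset.mem_Icc.1 k.2
  refine ⟨⟨(k : ℤ).natAbs, by omega⟩, ?_⟩
  rcases le_total 0 (k : ℤ) with h | h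
  · exact Or.inl (Subtype.ext (by simp [abs_of_nonneg h]))
  · exact Or.inr (Subtype.ext (by simp [abs_of_nonpos h]))

/-- A function on `{-n, …, n}` is odd if `x (-k) = -x k`. -/
def IsOdd (x : SignedRange n → ℤ) : Prop := ∀ k, x k.neg = -x k

namespace IsOdd

variable {x : SignedRange n → ℤ}

theorem apply_zero (hx : IsOdd x) : x (ofFin 0) = 0 := by
  have := hx (ofFin 0)
  rw [neg_ofFin_zero] at this
  omega

theorem monotone (hx : IsOdd x) (h : Monotone fun a => x (ofFin a)) : Monotone x := by
  intro k l hkl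
  have hkl := Subtype.coe_le_coe.2 hkl
  have h0 (a) : 0 ≤ x (ofFin a) := hx.apply_zero ▸ h (Fin.zero_le a)
  obtain ⟨a, rfl | rfl⟩ := k.exists_ofFin <;> obtain ⟨b, rfl | rfl⟩ := l.exists_ofFin
  · exact h (Fin.le_def.2 (by simpa using hkl))
  · have ha : a = 0 := Fin.ext (by rw [Fin.val_zero]; simp at hkl; omega)
    have hb : b = 0 := Fin.ext (by rw [Fin.val_zero]; simp at hkl; omega)
    rw [ha, hb, neg_ofFin_zero]
  · rw [hx]
    linarith [h0 a, h0 b]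
  · rw [hx, hx]
    exact neg_le_neg (h (Fin.le_def.2 (by simpa using hkl)))

theorem strictMono (hx : IsOdd x) (h : StrictMono fun a => x (ofFin a)) : StrictMono x := by
  refine (hx.monotone h.monotone).strictMono_of_injective fun k l hkl => ?_
  have h0 (a) : 0 ≤ x (ofFin a) := hx.apply_zero ▸ h.monotone (Fin.zero_le a)
  have hz (a) (ha : x (ofFin a) = 0) : a = 0 := h.injective (ha.trans hx.apply_zero.symm)
  obtain ⟨a, rfl | rfl⟩ := k.exists_ofFin <;> obtain ⟨b, rfl | rfl⟩ := l.exists_ofFin <;>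
    try simp only [hx _] at hkl
  · rw [h.injective hkl]
  · rw [hz a (by linarith [h0 a, h0 b]), hz b (by linarith [h0 a, h0 b]), neg_ofFin_zero]
  · rw [hz a (by linarith [h0 a, h0 b]), hz b (by linarith [h0 a, h0 b]), neg_ofFin_zero]
  · rw [h.injective (neg_inj.1 hkl)]

theorem ext {y : SignedRange n → ℤ} (hx : IsOdd x) (hy : IsOdd y)
    (h : ∀ a, x (ofFin a) = y (ofFin a)) : x = y := by
  funext k
  obtain ⟨a, rfl | rfl⟩ := k.exists_ofFin
  · exact h a
  · rw [hx, hy, h]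

end IsOdd

/-- The odd extension to `{-n, …, n}` of a sequence on `{0, …, n}`. -/
def oddExtend (v : Fin (n + 1) → ℤ) (k : SignedRange n) : ℤ :=
  (k : ℤ).sign * v ⟨(k : ℤ).natAbs, by have := Finset.mem_Icc.1 k.2; omega⟩

theorem isOdd_oddExtend (v : Fin (n + 1) → ℤ) : IsOdd (oddExtend v) := fun k => by
  simp [oddExtend]

theorem oddExtend_ofFin {v : Fin (n + 1) → ℤ} (hv : v 0 = 0) (a : Fin (n + 1)) :
    oddExtend v (ofFin a) = v a := by
  rcases eq_or_ne a 0 with rfl | ha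
  · simp [oddExtend, hv]
  · have : (a : ℕ) ≠ 0 := fun h => ha (Fin.ext h)
    simp [oddExtend, Int.sign_natCast_of_ne_zero this]

/-- Odd functions on `{-n, …, n}` with prescribed minimal steps on `{0, …, n}`. -/
def oddSequences (D : Fin n → ℕ) (i : ℤ) : Set (SignedRange n → ℤ) :=
  {x | IsOdd x ∧ (fun a => x (ofFin a)) ∈ stepSequences D i}

theorem bijOn_oddSequences (D : Fin n → ℕ) (i : ℤ) :
    Set.BijOn (fun x a => x (ofFin a)) (oddSequences D i) (stepSequences D i) := by
  refine ⟨fun x hx => hx.2, fun x hx y hy h => hx.1.ext hy.1 (congrFun h), fun v hv => ?_⟩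
  have : (fun a => oddExtend v (ofFin a)) = v := funext (oddExtend_ofFin hv.1)
  exact ⟨oddExtend v, ⟨isOdd_oddExtend v, by rwa [this]⟩, this⟩

theorem ncard_oddSequences (D : Fin n → ℕ) (i : ℕ) :
    ((oddSequences D i).ncard : ℤ) = shiftedChoose n (∑ k, D k) i := by
  rw [(bijOn_oddSequences D i).ncard_eq, ncard_stepSequences]

theorem finite_oddSequences (D : Fin n → ℕ) (i : ℤ) : (oddSequences D i).Finite :=
  (bijOn_oddSequences D i).finite_iff_finite.2 (finite_stepSequences D i)

theorem monotone_of_mem_oddSequences {D : Fin n → ℕ} {i : ℤ} {x : SignedRange n → ℤ}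
    (hx : x ∈ oddSequences D i) : Monotone x :=
  hx.1.monotone (monotone_of_mem_stepSequences hx.2)

theorem abs_le_of_mem_oddSequences {D : Fin n → ℕ} {i : ℤ} {x : SignedRange n → ℤ}
    (hx : x ∈ oddSequences D i) (k : SignedRange n) : |x k| ≤ i := by
  have hm := monotone_of_mem_stepSequences hx.2
  have key (a) : |x (ofFin a)| ≤ i := by
    rw [abs_of_nonneg (hx.1.apply_zero ▸ hm (Fin.zero_le a))]
    exact (hm (Fin.le_last a)).trans hx.2.2.2
  obtain ⟨a, rfl | rfl⟩ := k.exists_ofFin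
  · exact key a
  · rw [hx.1, abs_neg]
    exact key a

theorem mem_oddSequences_zero {i : ℤ} {x : SignedRange n → ℤ} :
    x ∈ oddSequences (0 : Fin n → ℕ) i ↔ IsOdd x ∧ Monotone x ∧ ∀ k, |x k| ≤ i := by
  refine ⟨fun hx => ⟨hx.1, monotone_of_mem_oddSequences hx, abs_le_of_mem_oddSequences hx⟩,
    fun ⟨h, hm, hb⟩ => ⟨h, h.apply_zero, fun k => ?_, (le_abs_self _).trans (hb _)⟩⟩
  simpa using hm (ofFin_strictMono.monotone k.castSucc_le_succ)

end SignedRange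

open SignedRange

/-! ### Sequences compatible with a signed permutation -/

section Compatible

variable {n : ℕ}

/-- The indicator function of the set of type `B` descents. -/
def descentIndicator (σ : hyperoctahedralGroup n) (k : Fin n) : ℕ :=
  if (σ.1 (ofFin k.castSucc) : ℤ) > (σ.1 (ofFin k.succ) : ℤ) then 1 else 0

theorem sum_descentIndicator (σ : hyperoctahedralGroup n) : ∑ k, descentIndicator σ k = desB σ := by
  rw [desB, Finset.card_filter]
  rfl

/-- Strictness exactly at descents means that the pairs (x_k, σ_k) increase lexicographically; since
|σ_k| ≤ n, the factor 2n + 1 encodes this order in one integer. -/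
theorem mem_oddSequences_descentIndicator {σ : hyperoctahedralGroup n} {i : ℤ}
    {x : SignedRange n → ℤ} :
    x ∈ oddSequences (descentIndicator σ) i ↔
      IsOdd x ∧ StrictMono (fun k => (2 * n + 1) * x k + σ.1 k) ∧ ∀ k, |x k| ≤ i := by
  have step (k : Fin n) : x (ofFin k.castSucc) + descentIndicator σ k ≤ x (ofFin k.succ) ↔
      (2 * n + 1) * x (ofFin k.castSucc) + σ.1 (ofFin k.castSucc) <
        (2 * n + 1) * x (ofFin k.succ) + σ.1 (ofFin k.succ) := by
    rw [pairing_lt_iff (abs_coe_le _) (abs_coe_le _), descentIndicator]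
    have : (σ.1 (ofFin k.castSucc) : ℤ) ≠ σ.1 (ofFin k.succ) := fun h =>
      (ofFin_strictMono k.castSucc_lt_succ).ne (σ.1.injective (Subtype.ext h))
    split_ifs <;> push_cast <;> omega
  constructor
  · intro hx
    refine ⟨hx.1, ?_, abs_le_of_mem_oddSequences hx⟩
    refine IsOdd.strictMono (fun k => ?_) (Fin.strictMono_iff_lt_succ.2 fun k => ?_)
    · rw [hx.1, σ.2, coe_neg]
      ring
    · exact (step k).1 (hx.2.2.1 k)
  · rintro ⟨h, hm, hb⟩
    exact ⟨h, h.apply_zero, fun k => (step k).2 (hm (ofFin_strictMono k.castSucc_lt_succ)),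
      (le_abs_self _).trans (hb _)⟩

theorem existsUnique_strictMono_comp_perm {α : Type*} [Fintype α] [LinearOrder α] {q : α → ℤ}
    (hq : Function.Injective q) : ∃! σ : Equiv.Perm α, StrictMono (q ∘ σ) := by
  refine existsUnique_of_exists_of_unique ?_ fun σ τ hσ hτ => ?_
  · let e := Fintype.orderIsoFinOfCardEq α rfl
    refine ⟨e.symm.toEquiv.trans ((Tuple.sort (q ∘ e)).trans e.toEquiv), ?_⟩
    have h : StrictMono ((q ∘ e) ∘ Tuple.sort (q ∘ e)) :=
      (Tuple.monotone_sort (q ∘ e)).strictMono_of_injective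
        ((hq.comp e.injective).comp (Equiv.injective _))
    exact h.comp e.symm.strictMono
  · have h : q ∘ σ = q ∘ τ := (hσ.range_inj hτ).1 (by
      rw [Set.range_comp, Set.range_comp, σ.surjective.range_eq, τ.surjective.range_eq])
    exact Equiv.ext fun k => hq (congrFun h k)

theorem pairing_id_injective (y : SignedRange n → ℤ) :
    Function.Injective fun k : SignedRange n => (2 * n + 1) * y k + k := fun k l h =>
  Subtype.ext (pairing_inj (abs_coe_le k) (abs_coe_le l) h).2

/-- The permutation sorting the pairs (y_k, k) is unique. As y is odd, its conjugate by negation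
sorts them too, so it is a signed permutation. -/
theorem exists_standardization {y : SignedRange n → ℤ} (hy : IsOdd y) :
    ∃ σ : hyperoctahedralGroup n, StrictMono fun k => (2 * n + 1) * y (σ.1 k) + σ.1 k := by
  obtain ⟨σ, hσ, huniq⟩ := existsUnique_strictMono_comp_perm (pairing_id_injective y)
  refine ⟨⟨σ, fun k => ?_⟩, hσ⟩
  let ν : Equiv.Perm (SignedRange n) :=
    ⟨SignedRange.neg, SignedRange.neg, by intro; simp, by intro; simp⟩
  have h : ν * σ * ν = σ := huniq _ fun k l hkl => by
    have := hσ (neg_lt_neg hkl)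
    simp only [Function.comp_apply, Equiv.Perm.mul_apply] at this ⊢
    change (2 * n + 1) * y (σ k.neg).neg + ((σ k.neg).neg : ℤ) <
      (2 * n + 1) * y (σ l.neg).neg + ((σ l.neg).neg : ℤ)
    rw [hy, hy, coe_neg, coe_neg]
    linarith
  have := DFunLike.congr_fun h k.neg
  change (σ k.neg.neg).neg = σ k.neg at this
  rw [← this, neg_neg]

theorem pairing_mem_oddSequences {σ : hyperoctahedralGroup n} {i j : ℕ} {f g : SignedRange n → ℤ}
    (hf : f ∈ oddSequences (descentIndicator σ) i)
    (hg : g ∈ oddSequences (descentIndicator σ⁻¹) j) :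
    (fun k => (2 * j + 1) * f k + g (σ.1 k)) ∈
      oddSequences (0 : Fin n → ℕ) (2 * i * j + i + j : ℕ) := by
  have hfb := abs_le_of_mem_oddSequences hf
  have hgb := abs_le_of_mem_oddSequences hg
  rw [mem_oddSequences_zero]
  refine ⟨fun k => ?_, fun k l hkl => ?_, fun k => ?_⟩
  · change (2 * (j : ℤ) + 1) * f k.neg + g (σ.1 k.neg) = -((2 * j + 1) * f k + g (σ.1 k))
    rw [σ.2, hf.1, hg.1]
    ring
  · rcases hkl.eq_or_lt with rfl | hkl
    · rfl
    have h := (mem_oddSequences_descentIndicator.1 hf).2.1 hkl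
    rcases (pairing_lt_iff (abs_coe_le _) (abs_coe_le _)).1 h with h | ⟨h, h'⟩
    · exact ((pairing_lt_iff (hgb _) (hgb _)).2 (Or.inl h)).le
    · have := monotone_of_mem_oddSequences hg (Subtype.coe_lt_coe.1 h').le
      simp only [h]
      linarith
  · have h1 := abs_le.1 (hfb k)
    have h2 := abs_le.1 (hgb (σ.1 k))
    push_cast
    exact abs_le.2 ⟨by nlinarith, by nlinarith⟩

/-- The bijection is (σ, f, g) ↦ (2j+1)f + g∘σ. The inverse splits z into quotient f and remainder
y, takes σ⁻¹ to be the permutation sorting the pairs (y_k, k), and puts g = y∘σ⁻¹. -/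
theorem sum_ncard_oddSequences (i j : ℕ) :
    ∑ σ : hyperoctahedralGroup n, (oddSequences (descentIndicator σ) i).ncard *
      (oddSequences (descentIndicator σ⁻¹) j).ncard =
    (oddSequences (0 : Fin n → ℕ) (2 * i * j + i + j : ℕ)).ncard := by
  have hfin (D : Fin n → ℕ) (i : ℤ) : Finite (oddSequences D i) :=
    (finite_oddSequences D i).to_subtype
  simp only [← Nat.card_coe_set_eq, ← Nat.card_prod]
  rw [← Nat.card_sigma]
  refine Nat.card_congr (Equiv.ofBijective
    (fun p => ⟨_, pairing_mem_oddSequences p.2.1.2 p.2.2.2⟩) ⟨?_, ?_⟩)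
  · rintro ⟨σ, ⟨f, hf⟩, ⟨g, hg⟩⟩ ⟨τ, ⟨f', hf'⟩, ⟨g', hg'⟩⟩ h
    have h := fun k => pairing_inj (abs_le_of_mem_oddSequences hg _)
      (abs_le_of_mem_oddSequences hg' _) (congrFun (congrArg Subtype.val h) k)
    obtain rfl : f = f' := funext fun k => (h k).1
    have h (k) : g (σ.1 k) = g' (τ.1 k) := (h k).2
    have hσ := (mem_oddSequences_descentIndicator.1 hg).2.1
    have hτ := (mem_oddSequences_descentIndicator.1 hg').2.1
    -- Both inverses sort the same pairs (g(σ k), k).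
    obtain rfl : σ = τ := by
      refine inv_injective (Subtype.ext ?_)
      refine (existsUnique_strictMono_comp_perm
        (pairing_id_injective fun k => g (σ.1 k))).unique ?_ ?_
      · have hinv (k) : g (σ.1 ((σ⁻¹).1 k)) = g k := by simp
        exact fun k l hkl => by simpa only [Function.comp_apply, hinv] using hσ hkl
      · have hinv (k) : g (σ.1 ((τ⁻¹).1 k)) = g' k := by rw [h]; simp
        exact fun k l hkl => by simpa only [Function.comp_apply, hinv] using hτ hkl
    obtain rfl : g = g' := funext fun k => by simpa using h (σ.1⁻¹ k)
    rfl
  · rintro ⟨z, hz⟩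
    obtain ⟨hodd, hmono, hb⟩ := mem_oddSequences_zero.1 hz
    choose x y hy hxy using fun k => exists_pairing (Int.natCast_nonneg j) (z k)
    have hneg (k) : x k.neg = -x k ∧ y k.neg = -y k := by
      refine pairing_inj (hy _) (by rw [abs_neg]; exact hy k) ?_
      rw [← hxy, hodd, hxy k]
      ring
    have hyodd : IsOdd y := fun k => (hneg k).2
    obtain ⟨σ, hσ⟩ := exists_standardization hyodd
    have hg : (fun k => y (σ.1 k)) ∈ oddSequences (descentIndicator σ⁻¹⁻¹) j := by
      rw [inv_inv, mem_oddSequences_descentIndicator]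
      exact ⟨fun k => (congrArg y (σ.2 k)).trans (hyodd _), hσ, fun k => hy _⟩
    have hf : x ∈ oddSequences (descentIndicator σ⁻¹) i := by
      rw [mem_oddSequences_descentIndicator]
      refine ⟨fun k => (hneg k).1, fun k l hkl => ?_, fun k => ?_⟩
      · have hz := hmono hkl.le
        rw [hxy k, hxy l, ← not_lt, pairing_lt_iff (hy _) (hy _)] at hz
        refine (pairing_lt_iff (abs_coe_le _) (abs_coe_le _)).2 ?_
        -- On a tie in x, monotonicity of z orders the remainders weakly, and k < l breaks ties
        -- among those.
        rcases lt_or_ge (x k) (x l) with h | h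
        · exact Or.inl h
        · have hx : x k = x l := by omega
          refine Or.inr ⟨hx, Subtype.coe_lt_coe.2 (hσ.lt_iff_lt.1 ?_)⟩
          have hinv (k) : σ.1 ((σ⁻¹).1 k) = k := by simp
          simp only [hinv]
          refine (pairing_lt_iff (abs_coe_le _) (abs_coe_le _)).2 ?_
          have := Subtype.coe_lt_coe.2 hkl
          omega
      · have h1 := abs_le.1 (hb k)
        have h2 := abs_le.1 (hy k)
        have h3 := hxy k
        push_cast at h1
        refine abs_le.2 ⟨?_, ?_⟩
        -- If |x_k| ≥ i + 1 then |z_k| ≥ (2j+1)(i+1) - j = 2ij+i+j+1, one too many.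
        · by_contra! hlt
          nlinarith
        · by_contra! hlt
          nlinarith
    refine ⟨⟨σ⁻¹, ⟨x, hf⟩, ⟨_, hg⟩⟩, Subtype.ext (funext fun k => ?_)⟩
    simp [hxy k]

/-- The generating function identity for type `B` two-sided Eulerian numbers, coefficientwise. -/
theorem sum_shiftedChoose_desB (i j : ℕ) :
    ∑ σ : hyperoctahedralGroup n, shiftedChoose n (desB σ) i * shiftedChoose n (desB σ⁻¹) j =
      ((2 * i * j + i + j + n).choose n : ℤ) := by
  have h := sum_ncard_oddSequences (n := n) i j
  zify at h
  have h0 := ncard_oddSequences (0 : Fin n → ℕ) (2 * i * j + i + j)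
  push_cast at h0
  rw [h0] at h
  simp only [ncard_oddSequences, sum_descentIndicator] at h
  rw [h, shiftedChoose_of_le] <;> simp

end Compatible

/-! ### Coefficient functionals and the generating function -/

/-- The coefficient of `s ^ i * t ^ j` in `p / ((1 - s) * (1 - t)) ^ (n + 1)`. -/
noncomputable def expansionCoeff (n i j : ℕ) : MvPolynomial (Fin 2) ℤ →ₗ[ℤ] ℤ :=
  (basisMonomials (Fin 2) ℤ).constr ℤ fun u => shiftedChoose n (u 0) i * shiftedChoose n (u 1) j

theorem expansionCoeff_monomial_one (n i j : ℕ) (u : Fin 2 →₀ ℕ) :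
    expansionCoeff n i j (monomial u 1) = shiftedChoose n (u 0) i * shiftedChoose n (u 1) j := by
  have h : (monomial u 1 : MvPolynomial (Fin 2) ℤ) = basisMonomials (Fin 2) ℤ u := by
    rw [coe_basisMonomials]
  rw [expansionCoeff, h, Module.Basis.constr_basis]

theorem monomial_one_fin_two (u : Fin 2 →₀ ℕ) :
    (monomial u 1 : MvPolynomial (Fin 2) ℤ) = X 0 ^ u 0 * X 1 ^ u 1 := by
  rw [monomial_eq, Finsupp.prod_fintype _ _ (by simp)]
  simp

theorem expansionCoeff_X_pow_mul_X_pow (n i j a b : ℕ) :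
    expansionCoeff n i j (X 0 ^ a * X 1 ^ b) = shiftedChoose n a i * shiftedChoose n b j := by
  have h := monomial_one_fin_two (Finsupp.equivFunOnFinite.symm ![a, b])
  have h' := expansionCoeff_monomial_one n i j (Finsupp.equivFunOnFinite.symm ![a, b])
  rw [h] at h'
  simpa using h'

theorem expansionCoeff_eq_sum (n i j : ℕ) (p : MvPolynomial (Fin 2) ℤ) :
    expansionCoeff n i j p =
      ∑ u ∈ p.support, p.coeff u * (shiftedChoose n (u 0) i * shiftedChoose n (u 1) j) := by
  conv_lhs => rw [p.as_sum]
  rw [map_sum]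
  refine Finset.sum_congr rfl fun u _ => ?_
  rw [← mul_one (coeff u p), ← smul_eq_mul, ← smul_monomial, map_smul, expansionCoeff_monomial_one]
  simp

/-- The functionals are unitriangular in the coefficients of p: only monomials dividing s^i t^j
contribute, and s^i t^j itself has weight 1. -/
theorem eq_zero_of_expansionCoeff_eq_zero {n : ℕ} {p : MvPolynomial (Fin 2) ℤ}
    (h : ∀ i j, expansionCoeff n i j p = 0) : p = 0 := by
  suffices ∀ m (u : Fin 2 →₀ ℕ), u 0 + u 1 = m → p.coeff u = 0 by
    ext u
    simpa using this _ u rfl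
  intro m
  induction m using Nat.strong_induction_on with
  | _ m ih =>
  rintro u rfl
  have hu := h (u 0) (u 1)
  rw [expansionCoeff_eq_sum, Finset.sum_eq_single u] at hu
  · simpa [shiftedChoose] using hu
  · intro v _ hvu
    by_cases h0 : v 0 ≤ u 0
    · by_cases h1 : v 1 ≤ u 1
      · have : ¬ (v 0 = u 0 ∧ v 1 = u 1) := fun h => hvu (by
          ext k
          fin_cases k
          · exact h.1
          · exact h.2)
        rw [ih _ (by omega) v rfl, zero_mul]
      · rw [shiftedChoose_of_lt (show u 1 < v 1 by omega)]
        simp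
    · rw [shiftedChoose_of_lt (show u 0 < v 0 by omega)]
      simp
  · intro hu
    rw [notMem_support_iff.1 hu, zero_mul]

theorem eq_of_expansionCoeff_eq {n : ℕ} {p q : MvPolynomial (Fin 2) ℤ}
    (h : ∀ i j, expansionCoeff n i j p = expansionCoeff n i j q) : p = q :=
  sub_eq_zero.1 (eq_zero_of_expansionCoeff_eq_zero (n := n) fun i j => by
    rw [map_sub, h, sub_self])

theorem expansionCoeff_eulerianB (n i j : ℕ) :
    expansionCoeff n i j (eulerianB n) = ((2 * i * j + i + j + n).choose n : ℤ) := by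
  simp only [eulerianB, map_sum, expansionCoeff_X_pow_mul_X_pow, sum_shiftedChoose_desB]

theorem eulerianB_one : eulerianB 1 = 1 + X 0 * X 1 := by
  refine eq_of_expansionCoeff_eq (n := 1) fun i j => ?_
  have h0 := expansionCoeff_X_pow_mul_X_pow 1 i j 0 0
  have h1 := expansionCoeff_X_pow_mul_X_pow 1 i j 1 1
  have hs (a : ℕ) : shiftedChoose 1 1 a = a := by
    cases a <;> simp [shiftedChoose]
  simp only [pow_zero, pow_one, mul_one] at h0 h1
  rw [expansionCoeff_eulerianB, map_add, h0, h1, hs, hs]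
  simp only [shiftedChoose, Nat.choose_one_right]
  push_cast
  simp
  ring

/-! ### The differential operator and the recurrence -/

/-- The differential operator relating consecutive type `B` two-sided Eulerian polynomials. -/
noncomputable def eulerianOperator (n : ℕ) (p : MvPolynomial (Fin 2) ℤ) :
    MvPolynomial (Fin 2) ℤ :=
  let s : MvPolynomial (Fin 2) ℤ := X 0
  let t : MvPolynomial (Fin 2) ℤ := X 1
  (2 * n ^ 2 * s * t - n * s * t + n) * p
    + (2 * n * s * t * (1 - s) + s * (1 - s) * (1 - t)) * pderiv 0 p
    + (2 * n * s * t * (1 - t) + t * (1 - s) * (1 - t)) * pderiv 1 p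
    + 2 * s * t * (1 - s) * (1 - t) * pderiv 0 (pderiv 1 p)

theorem X_mul_pderiv_zero (a b : ℕ) :
    (X 0 * pderiv 0 (X 0 ^ a * X 1 ^ b) : MvPolynomial (Fin 2) ℤ) =
      (a : MvPolynomial (Fin 2) ℤ) * (X 0 ^ a * X 1 ^ b) := by
  cases a <;> simp [Derivation.leibniz, Derivation.leibniz_pow, pderiv_X]
  ring

theorem X_mul_pderiv_one (a b : ℕ) :
    (X 1 * pderiv 1 (X 0 ^ a * X 1 ^ b) : MvPolynomial (Fin 2) ℤ) =
      (b : MvPolynomial (Fin 2) ℤ) * (X 0 ^ a * X 1 ^ b) := by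
  cases b <;> simp [Derivation.leibniz, Derivation.leibniz_pow, pderiv_X]
  ring

theorem X_mul_X_mul_pderiv_pderiv (a b : ℕ) :
    (X 0 * (X 1 * pderiv 0 (pderiv 1 (X 0 ^ a * X 1 ^ b))) : MvPolynomial (Fin 2) ℤ) =
      (a : MvPolynomial (Fin 2) ℤ) * (b : MvPolynomial (Fin 2) ℤ) * (X 0 ^ a * X 1 ^ b) := by
  have h : (X 1 * pderiv 0 (pderiv 1 (X 0 ^ a * X 1 ^ b)) : MvPolynomial (Fin 2) ℤ) =
      (b : MvPolynomial (Fin 2) ℤ) * pderiv 0 (X 0 ^ a * X 1 ^ b) := by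
    -- ∂/∂s commutes with multiplication by t.
    have h := congrArg (pderiv (0 : Fin 2)) (X_mul_pderiv_one a b)
    simpa [Derivation.leibniz (pderiv (0 : Fin 2)) (X 1) _,
      Derivation.leibniz (pderiv (0 : Fin 2)) (b : MvPolynomial (Fin 2) ℤ) _,
      pderiv_X, Pi.single_apply] using h
  rw [h, mul_left_comm, X_mul_pderiv_zero]
  ring

/-- With A = a + (n-a)s and B = b + (n-b)t, the multiplier of s^a t^b is 2AB + A(1-t) + (1-s)B +
n(1-s)(1-t), matching 2ij + i + j + n term by term. -/
theorem eulerianOperator_X_pow_mul_X_pow (n a b : ℕ) :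
    eulerianOperator n (X 0 ^ a * X 1 ^ b) =
      ((2 * a * b + a + b + n : ℤ)) • (X 0 ^ a * X 1 ^ b)
      + ((2 * (n - a) * b + (n - a) - b - n : ℤ)) • (X 0 ^ (a + 1) * X 1 ^ b)
      + ((2 * a * (n - b) - a + (n - b) - n : ℤ)) • (X 0 ^ a * X 1 ^ (b + 1))
      + ((2 * (n - a) * (n - b) - (n - a) - (n - b) + n : ℤ)) •
        (X 0 ^ (a + 1) * X 1 ^ (b + 1)) := by
  have h0 := X_mul_pderiv_zero a b
  have h1 := X_mul_pderiv_one a b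
  have h2 := X_mul_X_mul_pderiv_pderiv a b
  simp only [eulerianOperator, zsmul_eq_mul]
  push_cast
  linear_combination (2 * (n : MvPolynomial (Fin 2) ℤ) * X 1 * (1 - X 0) + (1 - X 0) * (1 - X 1)) * h0 +
    (2 * (n : MvPolynomial (Fin 2) ℤ) * X 0 * (1 - X 1) + (1 - X 0) * (1 - X 1)) * h1 +
    2 * (1 - X 0) * (1 - X 1) * h2

theorem eulerianOperator_add (n : ℕ) (p q : MvPolynomial (Fin 2) ℤ) :
    eulerianOperator n (p + q) = eulerianOperator n p + eulerianOperator n q := by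
  simp only [eulerianOperator, map_add]
  ring

theorem eulerianOperator_sum {ι : Type*} (n : ℕ) (s : Finset ι)
    (f : ι → MvPolynomial (Fin 2) ℤ) :
    eulerianOperator n (∑ k ∈ s, f k) = ∑ k ∈ s, eulerianOperator n (f k) :=
  map_sum (AddMonoidHom.mk' (eulerianOperator n) (eulerianOperator_add n)) f s

theorem expansionCoeff_eulerianOperator_monomial (n i j a b : ℕ) :
    expansionCoeff (n + 1) i j (eulerianOperator (n + 1) (X 0 ^ a * X 1 ^ b)) =
      (2 * i * j + i + j + (n + 1)) * expansionCoeff n i j (X 0 ^ a * X 1 ^ b) := by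
  rw [eulerianOperator_X_pow_mul_X_pow]
  simp only [map_add, map_smul, expansionCoeff_X_pow_mul_X_pow, smul_eq_mul]
  have d0 := shiftedChoose_sub n a i
  have d1 := shiftedChoose_sub n b j
  have e0 := mul_shiftedChoose n a i
  have e1 := mul_shiftedChoose n b j
  push_cast
  have key : ((2 * i * j + i + j + (n + 1)) : ℤ) * (shiftedChoose n a i * shiftedChoose n b j) =
      2 * (i * shiftedChoose n a i) * (j * shiftedChoose n b j) +
      (i * shiftedChoose n a i) * shiftedChoose n b j +
      shiftedChoose n a i * (j * shiftedChoose n b j) +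
      (n + 1) * (shiftedChoose n a i * shiftedChoose n b j) := by ring
  rw [key, ← e0, ← e1, ← d0, ← d1]
  ring

theorem eulerianB_succ (n : ℕ) :
    ((n + 1 : ℕ) : MvPolynomial (Fin 2) ℤ) * eulerianB (n + 1) =
      eulerianOperator (n + 1) (eulerianB n) := by
  refine eq_of_expansionCoeff_eq (n := n + 1) fun i j => ?_
  have h : expansionCoeff (n + 1) i j (eulerianOperator (n + 1) (eulerianB n)) =
      (2 * i * j + i + j + (n + 1)) * expansionCoeff n i j (eulerianB n) := by
    simp only [eulerianB, eulerianOperator_sum, map_sum, Finset.mul_sum,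
      expansionCoeff_eulerianOperator_monomial]
  rw [h, ← nsmul_eq_mul, map_nsmul, expansionCoeff_eulerianB, expansionCoeff_eulerianB,
    nsmul_eq_mul]
  -- Absorption identity for binomial coefficients: the whole recurrence at the level of
  -- coefficients.
  have hc := Nat.add_one_mul_choose_eq (2 * i * j + i + j + n) n
  rw [← add_assoc]
  push_cast [← @Nat.cast_inj ℤ] at hc ⊢
  linear_combination -hc

theorem mainTheorem3 (s t : MvPolynomial (Fin 2) ℤ) (hs : s = X 0) (ht : t = X 1) :
    eulerianB 1 = 1 + s * t ∧
    ∀ n : ℕ, 2 ≤ n →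
      (n : MvPolynomial (Fin 2) ℤ) * eulerianB n =
        (2 * n ^ 2 * s * t - n * s * t + n) * eulerianB (n - 1)
        + (2 * n * s * t * (1 - s) + s * (1 - s) * (1 - t)) * pderiv 0 (eulerianB (n - 1))
        + (2 * n * s * t * (1 - t) + t * (1 - s) * (1 - t)) * pderiv 1 (eulerianB (n - 1))
        + 2 * s * t * (1 - s) * (1 - t) * pderiv 0 (pderiv 1 (eulerianB (n - 1))) := by
  subst hs ht
  refine ⟨eulerianB_one, fun n hn => ?_⟩
  obtain ⟨m, rfl⟩ : ∃ m, n = m + 1 := ⟨n - 1, by omega⟩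
  exact eulerianB_succ m
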